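/- Let $H$ be a real separable Hilbert space and let $B:H\to H$ be a bounded, self-adjoint, strictly positive ($\langle Bx,x\rangle>0$ for $x\neq 0$), compact operator. Let $H_{-1}$ be the completion of $H$ with respect to the norm $\|x\|_{-1}=\langle Bx,x\rangle^{1/2}$. For $X\in\{H,H_{-1}\}$ let $\mathcal P_p(X)$ be the set of Borel probability measures on $X$ with finite $p$-th moment; a measure $\mu\in\mathcal P_1(H)$ is regarded as an element of $\mathcal P_1(H_{-1})$ via $F\mapsto\mu(F\cap H)$. Let $\mathbf d_{1,-1}(\mu,\nu)=\inf_\gamma\int\|x-y\|_{-1}\,\gamma(\mathrm dx,\mathrm dy)$ be the Wasserstein distance on $\mathcal P_1(H_{-1})$, the infimum being over the Borel probability measures $\gamma$ on $H_{-1}\times H_{-1}$ with marginals $\mu,\nu$. Let $T>0$, $m_0\in\mathcal P_2(H)$, and let $c,M\ge 0$ be arbitrary constants. Put $$Q=\Big\{\mu\in\mathcal P_1(H):\int_H\|x\|^2\,\mu(\mathrm dx)\le c\Big\},$$ $$C_{m_0}=\Big\{m:[0,T]\to Q\;:\;m(0)=m_0,\ \ \mathbf d_{1,-1}(m(t),m(s))\le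 M\sqrt{|t-s|}\ \text{ for all } s,t\in[0,T]\Big\}.$$ Then every $m\in C_{m_0}$ belongs to $C([0,T];(\mathcal P_1(H_{-1}),\mathbf d_{1,-1}))$, the set $C_{m_0}$ is convex (with respect to pointwise-in-time convex combinations of measures), and it is compact in $C([0,T];(\mathcal P_1(H_{-1}),\mathbf d_{1,-1}))$ with the metric $\rho_{-1,\infty}(m_1,m_2)=\max_{t\in[0,T]}\mathbf d_{1,-1}(m_1(t),m_2(t))$. -/

import Mathlib

open MeasureTheory ProbabilityTheory Set Filter Topology
open scoped ENNReal NNReal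

noncomputable section

namespace HilbertFlow

/-! ### Probability measures with finite moments and the Wasserstein distance -/

/-- `PSpace p X` is `𝒫_p(X)`: Borel probability measures on `X` with finite `p`-th moment. -/
@[ext]
structure PSpace (p : ℝ) (X : Type*) [NormedAddCommGroup X] [MeasurableSpace X] where
  meas : Measure X
  isProb : IsProbabilityMeasure meas
  moment : ∫⁻ x, ‖x‖ₑ ^ p ∂meas < ∞

attribute [instance] PSpace.isProb

/-- Probability measures on `X × X` with marginals `μ` and `ν` (the total mass is `1` as soon as
that of `μ` is). -/
def couplings {X : Type*} [MeasurableSpace X] (μ ν : Measure X) : Set (Measure (X × X)) :=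
  {γ | γ.map Prod.fst = μ ∧ γ.map Prod.snd = ν}

/-- The infimum of `∫ ‖x - y‖ dγ(x, y)` over all couplings `γ`, as an extended real. -/
def transportCost {X : Type*} [NormedAddCommGroup X] [MeasurableSpace X] (μ ν : Measure X) :
    ℝ≥0∞ :=
  ⨅ γ ∈ couplings μ ν, ∫⁻ z, ‖z.1 - z.2‖ₑ ∂γ

section Wasserstein

variable {X : Type*} [NormedAddCommGroup X] [MeasurableSpace X]

theorem transportCost_le {μ ν : Measure X} {γ : Measure (X × X)} (h : γ ∈ couplings μ ν) :
    transportCost μ ν ≤ ∫⁻ z, ‖z.1 - z.2‖ₑ ∂γ :=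
  iInf₂_le γ h

variable [BorelSpace X] [SecondCountableTopology X]

theorem measurable_cost : Measurable (fun z : X × X => ‖z.1 - z.2‖ₑ) :=
  (measurable_fst.sub measurable_snd).enorm

theorem transportCost_ne_top (μ ν : PSpace 1 X) : transportCost μ.meas ν.meas ≠ ∞ := by
  have hmem : μ.meas.prod ν.meas ∈ couplings μ.meas ν.meas := by
    constructor
    · simp [Measure.map_fst_prod]
    · simp [Measure.map_snd_prod]
  refine ne_top_of_le_ne_top ?_ (transportCost_le hmem)
  have hμ : ∫⁻ x, ‖x‖ₑ ∂μ.meas < ∞ := by simpa using μ.moment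
  have hν : ∫⁻ x, ‖x‖ₑ ∂ν.meas < ∞ := by simpa using ν.moment
  have hle : ∫⁻ z, ‖z.1 - z.2‖ₑ ∂(μ.meas.prod ν.meas)
      ≤ ∫⁻ z, (‖z.1‖ₑ + ‖z.2‖ₑ) ∂(μ.meas.prod ν.meas) :=
    lintegral_mono fun z => enorm_sub_le
  refine (hle.trans_lt ?_).ne
  rw [lintegral_add_left measurable_fst.enorm]
  have h1 : ∫⁻ z, ‖z.1‖ₑ ∂(μ.meas.prod ν.meas) = ∫⁻ x, ‖x‖ₑ ∂μ.meas := by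
    rw [← hmem.1, lintegral_map measurable_enorm measurable_fst, hmem.1]
  have h2 : ∫⁻ z, ‖z.2‖ₑ ∂(μ.meas.prod ν.meas) = ∫⁻ x, ‖x‖ₑ ∂ν.meas := by
    rw [← hmem.2, lintegral_map measurable_enorm measurable_snd, hmem.2]
  rw [h1, h2]
  exact ENNReal.add_lt_top.2 ⟨hμ, hν⟩

theorem transportCost_self (μ : Measure X) : transportCost μ μ = 0 := by
  have hd : Measurable (fun x : X => (x, x)) := measurable_id.prodMk measurable_id
  have hmem : μ.map (fun x => (x, x)) ∈ couplings μ μ := by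
    constructor
    · rw [Measure.map_map measurable_fst hd]; exact Measure.map_id
    · rw [Measure.map_map measurable_snd hd]; exact Measure.map_id
  refine le_antisymm ((transportCost_le hmem).trans ?_) bot_le
  rw [lintegral_map measurable_cost hd]
  simp

theorem transportCost_comm_le (μ ν : Measure X) : transportCost μ ν ≤ transportCost ν μ := by
  refine le_iInf₂ fun γ hγ => ?_
  have hmem : γ.map Prod.swap ∈ couplings μ ν := by
    constructor
    · rw [Measure.map_map measurable_fst measurable_swap]; exact hγ.2
    · rw [Measure.map_map measurable_snd measurable_swap]; exact hγ.1
  refine (transportCost_le hmem).trans ?_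
  rw [lintegral_map measurable_cost measurable_swap]
  exact (lintegral_congr fun z => by simp [enorm_sub_rev]).le

/-- Triangle inequality, by gluing two couplings along the common marginal. -/
theorem transportCost_triangle [CompleteSpace X] (μ ν ρ : Measure X) [IsProbabilityMeasure μ] :
    transportCost μ ρ ≤ transportCost μ ν + transportCost ν ρ := by
  have key : ∀ γ ∈ couplings μ ν, ∀ η ∈ couplings ν ρ,
      transportCost μ ρ ≤ ∫⁻ z, ‖z.1 - z.2‖ₑ ∂γ + ∫⁻ z, ‖z.1 - z.2‖ₑ ∂η := by
    intro γ hγ η hη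
    have hprob : IsProbabilityMeasure γ := by
      refine ⟨?_⟩
      have := measure_univ (μ := μ)
      rwa [← hγ.1, Measure.map_apply measurable_fst MeasurableSet.univ, preimage_univ] at this
    have hη' : IsProbabilityMeasure η := by
      refine ⟨?_⟩
      have h1 : η univ = ν univ := by
        rw [← hη.1, Measure.map_apply measurable_fst MeasurableSet.univ, preimage_univ]
      have h2 : γ univ = ν univ := by
        rw [← hγ.2, Measure.map_apply measurable_snd MeasurableSet.univ, preimage_univ]
      rw [h1, ← h2, measure_univ]
    have hν' : IsFiniteMeasure ν := by rw [← hη.1]; infer_instance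
    set κ : Kernel X X := η.condKernel with hκ
    have hdis : ν ⊗ₘ κ = η := by
      have := η.disintegrate η.condKernel
      rwa [Measure.fst, hη.1] at this
    set π : Measure ((X × X) × X) := γ ⊗ₘ (κ.comap Prod.snd measurable_snd) with hπ
    have hf : Measurable (fun w : (X × X) × X => (w.1.1, w.2)) := by fun_prop
    have hg : Measurable (fun w : (X × X) × X => (w.1.2, w.2)) := by fun_prop
    have hπ1 : π.map Prod.fst = γ := Measure.fst_compProd _ _
    have hπ2 : π.map (fun w => (w.1.2, w.2)) = η := by
      refine Measure.ext fun s hs => ?_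
      rw [Measure.map_apply hg hs, hπ, Measure.compProd_apply (hg hs), ← hdis,
        Measure.compProd_apply hs, ← hγ.2,
        lintegral_map (Kernel.measurable_kernel_prodMk_left hs) measurable_snd]
      rfl
    have hmem : π.map (fun w => (w.1.1, w.2)) ∈ couplings μ ρ := by
      constructor
      · rw [Measure.map_map measurable_fst hf, ← hγ.1, ← hπ1,
          Measure.map_map measurable_fst measurable_fst]
        rfl
      · rw [Measure.map_map measurable_snd hf, ← hη.2, ← hπ2,
          Measure.map_map measurable_snd hg]
        rfl
    refine (transportCost_le hmem).trans ?_
    rw [lintegral_map measurable_cost hf]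
    have hγc : ∫⁻ z, ‖z.1 - z.2‖ₑ ∂γ = ∫⁻ w, ‖w.1.1 - w.1.2‖ₑ ∂π := by
      rw [← hπ1, lintegral_map measurable_cost measurable_fst]
    have hηc : ∫⁻ z, ‖z.1 - z.2‖ₑ ∂η = ∫⁻ w, ‖w.1.2 - w.2‖ₑ ∂π := by
      rw [← hπ2, lintegral_map measurable_cost hg]
    have hm : Measurable (fun w : (X × X) × X => ‖w.1.1 - w.1.2‖ₑ) :=
      measurable_cost.comp measurable_fst
    rw [hγc, hηc, ← lintegral_add_left hm]
    refine lintegral_mono fun w => ?_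
    have : w.1.1 - w.2 = (w.1.1 - w.1.2) + (w.1.2 - w.2) := by abel
    simp only [this]
    exact enorm_add_le _ _
  unfold transportCost at key ⊢
  simp only [ENNReal.iInf_add, ENNReal.add_iInf]
  exact le_iInf₂ fun η hη => le_iInf₂ fun γ hγ => key γ hγ η hη

theorem lintegral_le_of_transportCost_eq_zero {μ ν : Measure X} {K : ℝ≥0} {f : X → ℝ≥0}
    (hf : LipschitzWith K f) (h : transportCost μ ν = 0) : ∫⁻ x, f x ∂μ ≤ ∫⁻ x, f x ∂ν := by
  have hm : Measurable (fun x => (f x : ℝ≥0∞)) := hf.continuous.measurable.coe_nnreal_ennreal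
  have key : ∀ γ ∈ couplings μ ν,
      ∫⁻ x, f x ∂μ ≤ ∫⁻ x, f x ∂ν + K * ∫⁻ z, ‖z.1 - z.2‖ₑ ∂γ := by
    intro γ hγ
    have hm2 : Measurable (fun z : X × X => (f z.2 : ℝ≥0∞)) := hm.comp measurable_snd
    rw [← hγ.1, ← hγ.2, lintegral_map hm measurable_fst, lintegral_map hm measurable_snd,
      ← lintegral_const_mul _ measurable_cost, ← lintegral_add_left hm2]
    refine lintegral_mono fun z => ?_
    have h1 : f z.1 ≤ f z.2 + K * ‖z.1 - z.2‖₊ := by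
      have h2 := hf.dist_le_mul z.1 z.2
      have h3 : (f z.1 : ℝ) - f z.2 ≤ K * ‖z.1 - z.2‖ := by
        rw [NNReal.dist_eq, dist_eq_norm] at h2
        exact (le_abs_self _).trans h2
      rw [← NNReal.coe_le_coe]
      push_cast
      linarith
    calc (f z.1 : ℝ≥0∞) ≤ ((f z.2 + K * ‖z.1 - z.2‖₊ : ℝ≥0) : ℝ≥0∞) := ENNReal.coe_le_coe.2 h1
      _ = f z.2 + K * ‖z.1 - z.2‖ₑ := by rw [ENNReal.coe_add, ENNReal.coe_mul, enorm_eq_nnnorm]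
  refine ENNReal.le_of_forall_pos_le_add fun ε hε _ => ?_
  have hpos : (0 : ℝ≥0∞) < ((ε / (K + 1) : ℝ≥0) : ℝ≥0∞) := by
    exact_mod_cast div_pos hε (by positivity)
  rw [← h, transportCost] at hpos
  obtain ⟨γ, hγ⟩ := iInf_lt_iff.1 hpos
  obtain ⟨hγm, hγ⟩ := iInf_lt_iff.1 hγ
  refine (key γ hγm).trans ?_
  gcongr
  refine (mul_le_mul_right hγ.le _).trans ?_
  have h5 : K * (ε / (K + 1)) ≤ ε := by
    rw [← mul_div_assoc, div_le_iff₀ (by positivity), mul_comm]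
    gcongr
    exact le_self_add
  exact_mod_cast h5

theorem eq_of_transportCost_eq_zero {μ ν : Measure X} [IsProbabilityMeasure μ]
    [IsProbabilityMeasure ν] (h : transportCost μ ν = 0) : μ = ν := by
  have h' : transportCost ν μ = 0 := le_antisymm ((transportCost_comm_le ν μ).trans h.le) bot_le
  have hclosed : ∀ F : Set X, IsClosed F → μ F = ν F := by
    intro F hF
    have hpos : ∀ n : ℕ, 0 < 1 / ((n : ℝ) + 1) := fun n => Nat.one_div_pos_of_nat
    have hlim : Tendsto (fun n : ℕ => 1 / ((n : ℝ) + 1)) atTop (𝓝 0) :=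
      tendsto_one_div_add_atTop_nhds_zero_nat
    have h1 := tendsto_lintegral_thickenedIndicator_of_isClosed μ hF hpos hlim
    have h2 := tendsto_lintegral_thickenedIndicator_of_isClosed ν hF hpos hlim
    refine tendsto_nhds_unique h1 (h2.congr fun n => ?_)
    have hl := lipschitzWith_thickenedIndicator (hpos n) F
    refine le_antisymm ?_ ?_
    · exact lintegral_le_of_transportCost_eq_zero hl h'
    · exact lintegral_le_of_transportCost_eq_zero hl h
  refine ext_of_generate_finite _ (BorelSpace.measurable_eq.trans borel_eq_generateFrom_isClosed)
    isPiSystem_isClosed (fun F hF => hclosed F hF) (by simp)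

/-- `𝒫_1(X)` with the Wasserstein distance
`d_1(μ, ν) = inf_γ ∫ ‖x - y‖ dγ(x, y)`, for `X` complete and separable. -/
instance instMetricSpacePSpace [CompleteSpace X] : MetricSpace (PSpace 1 X) where
  dist μ ν := (transportCost μ.meas ν.meas).toReal
  dist_self μ := by simp [transportCost_self]
  dist_comm μ ν := congrArg ENNReal.toReal
    (le_antisymm (transportCost_comm_le _ _) (transportCost_comm_le _ _))
  dist_triangle μ ν ρ := by
    rw [← ENNReal.toReal_add (transportCost_ne_top μ ν) (transportCost_ne_top ν ρ)]
    exact ENNReal.toReal_mono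
      (ENNReal.add_ne_top.2 ⟨transportCost_ne_top μ ν, transportCost_ne_top ν ρ⟩)
      (transportCost_triangle _ _ _)
  eq_of_dist_eq_zero {μ ν} h := by
    rcases (ENNReal.toReal_eq_zero_iff _).1 h with h | h
    · exact PSpace.ext (eq_of_transportCost_eq_zero h)
    · exact absurd h (transportCost_ne_top μ ν)

end Wasserstein

/-! ### The space `H₋₁` -/

variable {H : Type*} [NormedAddCommGroup H] [InnerProductSpace ℝ H] [CompleteSpace H]

/-- A bounded, self-adjoint, strictly positive operator on `H`. -/
structure StrictlyPositiveOperator (H : Type*) [NormedAddCommGroup H] [InnerProductSpace ℝ H]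
    [CompleteSpace H] where
  op : H →L[ℝ] H
  isSelfAdjoint : IsSelfAdjoint op
  strictlyPositive : ∀ x : H, x ≠ 0 → 0 < inner ℝ (op x) x

/-- A copy of the vector space `H`, to be equipped with the inner product `⟨B x, y⟩`. -/
def PreWeak (_B : StrictlyPositiveOperator H) : Type _ := H

instance (B : StrictlyPositiveOperator H) : AddCommGroup (PreWeak B) :=
  inferInstanceAs (AddCommGroup H)

instance (B : StrictlyPositiveOperator H) : Module ℝ (PreWeak B) :=
  inferInstanceAs (Module ℝ H)

/-- The inner product `⟨x, y⟩₋₁ = ⟨B x, y⟩`. -/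
@[reducible]
def weakCore (B : StrictlyPositiveOperator H) : InnerProductSpace.Core ℝ (PreWeak B) where
  inner x y := inner ℝ (B.op (show H from x)) (show H from y)
  conj_inner_symm x y :=
    (real_inner_comm _ _).trans (B.isSelfAdjoint.isSymmetric (show H from x) (show H from y)).symm
  re_inner_nonneg x := by
    by_cases hx : (show H from x) = 0
    · exact (inner_zero_right (𝕜 := ℝ) (B.op (show H from x)) ▸ hx ▸ le_rfl :
        0 ≤ inner ℝ (B.op (show H from x)) (show H from x))
    · exact (B.strictlyPositive _ hx).le
  add_left x y z :=
    (congrArg (fun u => inner ℝ u (show H from z))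
      (map_add B.op (show H from x) (show H from y))).trans (inner_add_left _ _ _)
  smul_left x y r :=
    (congrArg (fun u => inner ℝ u (show H from y))
      (map_smul B.op r (show H from x))).trans (inner_smul_left _ _ _)
  definite x hx := by
    by_contra h
    exact (B.strictlyPositive _ h).ne' hx

instance (B : StrictlyPositiveOperator H) : NormedAddCommGroup (PreWeak B) :=
  (weakCore B).toNormedAddCommGroup

instance (B : StrictlyPositiveOperator H) : InnerProductSpace ℝ (PreWeak B) :=
  InnerProductSpace.ofCore (weakCore B).toCore

/-- `H₋₁`: the completion of `H` for the norm `‖x‖₋₁ = ⟨B x, x⟩^(1/2)`; a Hilbert space. -/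
abbrev WeakSpace (B : StrictlyPositiveOperator H) : Type _ := UniformSpace.Completion (PreWeak B)

instance (B : StrictlyPositiveOperator H) : MeasurableSpace (WeakSpace B) := borel _

instance (B : StrictlyPositiveOperator H) : BorelSpace (WeakSpace B) := ⟨rfl⟩

/-- The identity `H → H`, with the second copy carrying the norm `‖·‖₋₁`. -/
def toPreWeak (B : StrictlyPositiveOperator H) (x : H) : PreWeak B := x

theorem norm_toPreWeak (B : StrictlyPositiveOperator H) (x : H) :
    ‖toPreWeak B x‖ = √(inner ℝ (B.op x) x) := rfl

theorem norm_toPreWeak_le (B : StrictlyPositiveOperator H) (x : H) :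
    ‖toPreWeak B x‖ ≤ √‖B.op‖ * ‖x‖ := by
  rw [norm_toPreWeak]
  refine Real.sqrt_le_iff.2 ⟨by positivity, ?_⟩
  rw [mul_pow, Real.sq_sqrt (norm_nonneg _)]
  calc inner ℝ (B.op x) x ≤ ‖B.op x‖ * ‖x‖ := real_inner_le_norm _ _
    _ ≤ ‖B.op‖ * ‖x‖ * ‖x‖ := by gcongr; exact B.op.le_opNorm x
    _ = ‖B.op‖ * ‖x‖ ^ 2 := by ring

/-- The canonical embedding `H → H₋₁`. -/
def toWeak (B : StrictlyPositiveOperator H) (x : H) : WeakSpace B := (toPreWeak B x : WeakSpace B)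

theorem norm_toWeak_le (B : StrictlyPositiveOperator H) (x : H) :
    ‖toWeak B x‖ ≤ √‖B.op‖ * ‖x‖ :=
  (UniformSpace.Completion.norm_coe (toPreWeak B x)).trans_le (norm_toPreWeak_le B x)

theorem continuous_toPreWeak (B : StrictlyPositiveOperator H) : Continuous (toPreWeak B) :=
  AddMonoidHomClass.continuous_of_bound
    (⟨⟨toPreWeak B, rfl⟩, fun _ _ => rfl⟩ : H →+ PreWeak B) (√‖B.op‖) (norm_toPreWeak_le B)

theorem continuous_toWeak (B : StrictlyPositiveOperator H) : Continuous (toWeak B) :=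
  (UniformSpace.Completion.continuous_coe _).comp (continuous_toPreWeak B)

instance [TopologicalSpace.SeparableSpace H] (B : StrictlyPositiveOperator H) :
    TopologicalSpace.SeparableSpace (PreWeak B) :=
  (Function.Surjective.denseRange (f := toPreWeak B) fun x => ⟨x, rfl⟩).separableSpace
    (continuous_toPreWeak B)

instance [TopologicalSpace.SeparableSpace H] (B : StrictlyPositiveOperator H) :
    SecondCountableTopology (WeakSpace B) :=
  UniformSpace.secondCountable_of_separable _

variable [MeasurableSpace H] [BorelSpace H]

/-- A measure `μ ∈ 𝒫_1(H)` regarded as an element of `𝒫_1(H₋₁)`, i.e. `F ↦ μ(F ∩ H)`. -/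
def PSpace.toWeak (B : StrictlyPositiveOperator H) (μ : PSpace 1 H) : PSpace 1 (WeakSpace B) where
  meas := μ.meas.map (HilbertFlow.toWeak B)
  isProb := Measure.isProbabilityMeasure_map (continuous_toWeak B).measurable.aemeasurable
  moment := by
    have hμ : ∫⁻ x, ‖x‖ₑ ∂μ.meas < ∞ := by simpa using μ.moment
    simp only [ENNReal.rpow_one]
    rw [lintegral_map measurable_enorm (continuous_toWeak B).measurable]
    have hle : ∀ x : H, ‖HilbertFlow.toWeak B x‖ₑ ≤ ENNReal.ofReal (√‖B.op‖) * ‖x‖ₑ := by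
      intro x
      rw [← ofReal_norm, ← ofReal_norm, ← ENNReal.ofReal_mul (Real.sqrt_nonneg _)]
      exact ENNReal.ofReal_le_ofReal (norm_toWeak_le B x)
    refine (lintegral_mono hle).trans_lt ?_
    rw [lintegral_const_mul _ measurable_enorm]
    exact ENNReal.mul_lt_top ENNReal.ofReal_lt_top hμ

/-! ### The sets of measures and flows -/

/-- `Q`: the measures in `𝒫_1(H)` with `∫ ‖x‖² dμ ≤ c`. -/
def momentBall (H : Type*) [NormedAddCommGroup H] [MeasurableSpace H] (c : ℝ≥0) :
    Set (PSpace 1 H) :=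
  {μ | ∫⁻ x, ‖x‖ₑ ^ 2 ∂μ.meas ≤ c}

/-- The set of all `m : [0,T] → Q` with `m(0) = m₀` and
`d_{1,-1}(m(t), m(s)) ≤ M √|t - s|` for all `s, t ∈ [0,T]`. -/
def holderFlows [TopologicalSpace.SeparableSpace H] (B : StrictlyPositiveOperator H) {T : ℝ}
    (hT : 0 < T) (m₀ : PSpace 2 H) (c M : ℝ≥0) : Set (Icc 0 T → PSpace 1 H) :=
  {m | (∀ t, m t ∈ momentBall H c) ∧ (m ⟨0, left_mem_Icc.2 hT.le⟩).meas = m₀.meas ∧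
    ∀ s t : Icc 0 T,
      dist ((m t).toWeak B) ((m s).toWeak B) ≤ M * √|(t : ℝ) - (s : ℝ)|}

/-- The same set, viewed inside `C([0,T]; (𝒫_1(H₋₁), d_{1,-1}))` with its uniform metric. -/
def holderFlowsInC [TopologicalSpace.SeparableSpace H] (B : StrictlyPositiveOperator H) {T : ℝ}
    (hT : 0 < T) (m₀ : PSpace 2 H) (c M : ℝ≥0) : Set C(Icc 0 T, PSpace 1 (WeakSpace B)) :=
  {f | ∃ m ∈ holderFlows B hT m₀ c M, ∀ t, f t = (m t).toWeak B}

/-- A flow of measures as a function with values in the vector space of finite signed measures;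
convexity of a set of flows refers to the linear structure of this space. -/
def toSignedFlow {I X : Type*} [TopologicalSpace I] [NormedAddCommGroup X] [MeasurableSpace X]
    [TopologicalSpace (PSpace 1 X)] (f : C(I, PSpace 1 X)) : I → SignedMeasure X :=
  fun t => (f t).meas.toSignedMeasure

end HilbertFlow

end

open HilbertFlow

/-!
Let `ι : H → H₋₁` be the embedding. By the layer-cake formula the second moment of `μ` is the
integral over `t > 0` of the masses which `ι_* μ` gives to the complements of `ι (B(0, √t))`. These
images of balls are closed, because balls of `H` are weakly compact, so the second moment is lower
semicontinuous under weak convergence in `H₋₁`, and a finite value forces a limit measure to be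
carried by `H`. As `‖x‖₋₁² ≤ ‖B x‖ ‖x‖`, compactness of `B` makes `ι` compact; the images of balls
are then compact, and the measures in `Q` are uniformly tight in `H₋₁` together with their first
moments. Prokhorov's theorem yields weakly convergent subfamilies of `Q`, and uniform tightness of
the first moments turns weak convergence into convergence for `d_{1,-1}`: discretizing along a
continuous partition of unity costs little, and the discrete measures have the same nodes and
converging weights. So `Q` is compact for `d_{1,-1}`, and Arzelà–Ascoli applies to the flows.
Convexity holds because adding couplings shows that `d_{1,-1}` is jointly convex.
-/

namespace HilbertFlow

section Couplings

variable {X : Type*} [MeasurableSpace X]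

theorem add_mem_couplings {μ μ' ν ν' : Measure X} {γ γ' : Measure (X × X)}
    (h : γ ∈ couplings μ ν) (h' : γ' ∈ couplings μ' ν') : γ + γ' ∈ couplings (μ + μ') (ν + ν') :=
  ⟨by rw [Measure.map_add _ _ measurable_fst, h.1, h'.1],
    by rw [Measure.map_add _ _ measurable_snd, h.2, h'.2]⟩

theorem smul_mem_couplings (a : ℝ≥0∞) {μ ν : Measure X} {γ : Measure (X × X)}
    (h : γ ∈ couplings μ ν) : a • γ ∈ couplings (a • μ) (a • ν) :=
  ⟨by rw [Measure.map_smul, h.1], by rw [Measure.map_smul, h.2]⟩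

theorem couplings_nonempty {μ ν : Measure X} [IsFiniteMeasure ν] (h : μ univ = ν univ) :
    (couplings μ ν).Nonempty := by
  rcases eq_or_ne (ν univ) 0 with h0 | h0
  · rw [Measure.measure_univ_eq_zero.1 (h.trans h0), Measure.measure_univ_eq_zero.1 h0]
    exact ⟨0, by simp [couplings]⟩
  have hcancel : (ν univ)⁻¹ * ν univ = 1 := ENNReal.inv_mul_cancel h0 (measure_ne_top ν univ)
  refine ⟨(ν univ)⁻¹ • μ.prod ν, ?_, ?_⟩
  · rw [Measure.map_smul, Measure.map_fst_prod, smul_smul, hcancel, one_smul]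
  · rw [Measure.map_smul, Measure.map_snd_prod, h, smul_smul, hcancel, one_smul]

end Couplings

section TransportCost

variable {X : Type*} [NormedAddCommGroup X] [MeasurableSpace X]

theorem transportCost_add_le (μ μ' ν ν' : Measure X) :
    transportCost (μ + μ') (ν + ν') ≤ transportCost μ ν + transportCost μ' ν' := by
  simp_rw [transportCost.eq_def μ, transportCost.eq_def μ', ENNReal.iInf_add, ENNReal.add_iInf,
    ← lintegral_add_measure]
  exact le_iInf₂ fun γ hγ => le_iInf₂ fun γ' hγ' => transportCost_le (add_mem_couplings hγ hγ')

theorem transportCost_smul_le (a : ℝ≥0) (μ ν : Measure X) :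
    transportCost (a • μ) (a • ν) ≤ a * transportCost μ ν := by
  rcases eq_or_ne a 0 with rfl | ha
  · have hzero : (0 : Measure (X × X)) ∈ couplings 0 0 := by simp [couplings]
    simpa using transportCost_le hzero
  simp_rw [transportCost.eq_def μ, ENNReal.mul_iInf_of_ne (ENNReal.coe_ne_zero.2 ha)
    ENNReal.coe_ne_top, ← smul_eq_mul, ← lintegral_smul_measure]
  exact le_iInf₂ fun γ hγ => transportCost_le (smul_mem_couplings a hγ)

variable [BorelSpace X]

theorem transportCost_le_lintegral_enorm_add {μ ν : Measure X} [IsFiniteMeasure ν]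
    (h : μ univ = ν univ) :
    transportCost μ ν ≤ ∫⁻ x, ‖x‖ₑ ∂μ + ∫⁻ x, ‖x‖ₑ ∂ν := by
  obtain ⟨γ, hγ⟩ := couplings_nonempty h
  calc transportCost μ ν ≤ ∫⁻ z, ‖z.1 - z.2‖ₑ ∂γ := transportCost_le hγ
    _ ≤ ∫⁻ z, (‖z.1‖ₑ + ‖z.2‖ₑ) ∂γ := lintegral_mono fun z => enorm_sub_le
    _ = ∫⁻ x, ‖x‖ₑ ∂μ + ∫⁻ x, ‖x‖ₑ ∂ν := by
      rw [lintegral_add_left measurable_fst.enorm, ← hγ.1, ← hγ.2,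
        lintegral_map measurable_enorm measurable_fst,
        lintegral_map measurable_enorm measurable_snd]

variable [SecondCountableTopology X]

theorem transportCost_sum_le {ι : Type*} (s : Finset ι) (μ ν : ι → Measure X) :
    transportCost (∑ i ∈ s, μ i) (∑ i ∈ s, ν i) ≤ ∑ i ∈ s, transportCost (μ i) (ν i) := by
  classical
  induction s using Finset.induction_on with
  | empty => simp [transportCost_self]
  | insert i s hi ih =>
    simp_rw [Finset.sum_insert hi]
    exact (transportCost_add_le _ _ _ _).trans (by gcongr)

theorem transportCost_smul_dirac_le (μ : Measure X) (y : X) :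
    transportCost μ (μ univ • Measure.dirac y) ≤ ∫⁻ x, ‖x - y‖ₑ ∂μ := by
  have hpair : Measurable fun x : X => (x, y) := by fun_prop
  have hmem : μ.map (fun x => (x, y)) ∈ couplings μ (μ univ • Measure.dirac y) := by
    constructor
    · rw [Measure.map_map measurable_fst hpair]
      exact Measure.map_id
    · rw [Measure.map_map measurable_snd hpair]
      exact Measure.map_const μ y
  exact (transportCost_le hmem).trans (lintegral_map measurable_cost hpair).le

/-- Common mass stays put, so only the excesses `w i - w' i` and `w' i - w i` are moved. -/
theorem transportCost_sum_smul_dirac_le {ι : Type*} [Fintype ι] (y : ι → X) {w w' : ι → ℝ≥0}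
    (h : ∑ i, w i = ∑ i, w' i) :
    transportCost (∑ i, w i • Measure.dirac (y i)) (∑ i, w' i • Measure.dirac (y i)) ≤
      ∑ i, edist (w i) (w' i) * ‖y i‖ₑ := by
  have split (v v' : ι → ℝ≥0) : ∑ i, v i • Measure.dirac (y i) =
      ∑ i, min (v i) (v' i) • Measure.dirac (y i) + ∑ i, (v i - v' i) • Measure.dirac (y i) := by
    simp_rw [← Finset.sum_add_distrib, ← add_smul, add_comm (min _ _), tsub_add_min]
  have excess : ∑ i, (w i - w' i) = ∑ i, (w' i - w i) := by
    refine add_right_cancel (b := ∑ i, min (w i) (w' i)) ?_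
    simp_rw [← Finset.sum_add_distrib, tsub_add_min, min_comm (w _), tsub_add_min, h]
  have edist_eq (a b : ℝ≥0) : edist a b = (a - b : ℝ≥0) + (b - a : ℝ≥0) := by
    rw [edist_nndist, NNReal.nndist_eq, ← ENNReal.coe_add]
    rcases le_total a b with hab | hab <;> simp [tsub_eq_zero_of_le hab]
  have hmass : (∑ i, (w i - w' i) • Measure.dirac (y i)) univ =
      (∑ i, (w' i - w i) • Measure.dirac (y i)) univ := by
    simpa [Measure.finsetSum_apply, ENNReal.smul_def] using congrArg ENNReal.ofNNReal excess
  rw [split w w', split w' w]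
  simp_rw [min_comm (w' _)]
  refine (transportCost_add_le _ _ _ _).trans ?_
  rw [transportCost_self, zero_add]
  refine (transportCost_le_lintegral_enorm_add hmass).trans (le_of_eq ?_)
  simp_rw [edist_eq, add_mul, Finset.sum_add_distrib, lintegral_finsetSum_measure,
    lintegral_smul_measure, lintegral_dirac, ENNReal.smul_def, smul_eq_mul]

theorem transportCost_sum_lintegral_smul_dirac_le {ι : Type*} [Fintype ι] {φ : ι → X → ℝ≥0∞}
    (hφ : ∀ i, Measurable (φ i)) (hsum : ∑ i, φ i = 1) (y : ι → X) (μ : Measure X) :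
    transportCost μ (∑ i, (∫⁻ x, φ i x ∂μ) • Measure.dirac (y i)) ≤
      ∫⁻ x, ∑ i, φ i x * ‖x - y i‖ₑ ∂μ := by
  have hμ : ∑ i, μ.withDensity (φ i) = μ := by
    rw [← Measure.sum_fintype, ← withDensity_tsum hφ, tsum_fintype, hsum, withDensity_one]
  have hmass (i : ι) : ∫⁻ x, φ i x ∂μ = μ.withDensity (φ i) univ := by
    rw [withDensity_apply _ MeasurableSet.univ, setLIntegral_univ]
  calc transportCost μ (∑ i, (∫⁻ x, φ i x ∂μ) • Measure.dirac (y i))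
      = transportCost (∑ i, μ.withDensity (φ i))
          (∑ i, μ.withDensity (φ i) univ • Measure.dirac (y i)) := by simp_rw [hμ, hmass]
    _ ≤ ∑ i, ∫⁻ x, ‖x - y i‖ₑ ∂μ.withDensity (φ i) :=
      (transportCost_sum_le _ _ _).trans
        (Finset.sum_le_sum fun i _ => transportCost_smul_dirac_le _ (y i))
    _ = ∫⁻ x, ∑ i, φ i x * ‖x - y i‖ₑ ∂μ := by
      rw [lintegral_finsetSum _ fun i _ => by fun_prop]
      exact Finset.sum_congr rfl fun i _ =>
        lintegral_withDensity_eq_lintegral_mul _ (hφ i) (by fun_prop)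

end TransportCost

open scoped BoundedContinuousFunction

section Partition

theorem exists_boundedContinuous_partition_subordinate {ι X : Type*} [Fintype ι]
    [TopologicalSpace X] [NormalSpace X] {U : ι → Set X} (ho : ∀ i, IsOpen (U i))
    (hU : ⋃ i, U i = univ) :
    ∃ φ : ι → X →ᵇ ℝ≥0, (∀ x, ∑ i, φ i x = 1) ∧ ∀ i x, φ i x ≠ 0 → x ∈ U i := by
  obtain ⟨ψ, hψ⟩ := PartitionOfUnity.exists_isSubordinate_of_locallyFinite isClosed_univ U ho
    (locallyFinite_of_finite U) hU.ge
  refine ⟨fun i => (BoundedContinuousFunction.ofNormedAddCommGroup (ψ i) (ψ i).continuous 1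
    fun x => (Real.norm_of_nonneg (ψ.nonneg i x)).trans_le (ψ.le_one i x)).nnrealPart,
    fun x => ?_, fun i x hx => hψ i (subset_closure fun h => hx ?_)⟩
  · have hsum := ψ.sum_eq_one (mem_univ x)
    rw [finsum_eq_sum_of_fintype] at hsum
    simp [BoundedContinuousFunction.nnrealPart_coeFn_eq,
      ← Real.toNNReal_sum_of_nonneg fun i _ => ψ.nonneg i x, hsum]
  · simp [BoundedContinuousFunction.nnrealPart_coeFn_eq, h]

variable {X : Type*} [NormedAddCommGroup X]

theorem exists_boundedContinuous_sum_mul_enorm_sub_le {C : Set X} (hC : IsCompact C) {ε : ℝ≥0∞}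
    (hε : 0 < ε) : ∃ (t : Finset X) (φ : Option t → X →ᵇ ℝ≥0) (y : Option t → X),
      (∀ x, ∑ i, φ i x = 1) ∧
        ∀ x, ∑ i, φ i x * ‖x - y i‖ₑ ≤ ε + Cᶜ.indicator (fun x => ‖x‖ₑ) x := by
  obtain ⟨t, -, ht⟩ := hC.elim_nhds_subcover (fun x => Metric.eball x ε)
    fun x _ => Metric.eball_mem_nhds x hε
  let U : Option t → Set X := fun i => i.elim Cᶜ fun x => Metric.eball x ε
  let y : Option t → X := fun i => i.elim 0 Subtype.val
  have hU : ⋃ i, U i = univ := eq_univ_of_forall fun x => by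
    by_cases hx : x ∈ C
    · obtain ⟨z, hz, hxz⟩ := mem_iUnion₂.1 (ht hx)
      exact mem_iUnion.2 ⟨some ⟨z, hz⟩, hxz⟩
    · exact mem_iUnion.2 ⟨none, hx⟩
  have hy : ∀ i, ∀ x ∈ U i, ‖x - y i‖ₑ ≤ ε + Cᶜ.indicator (fun x => ‖x‖ₑ) x
    | none, x, hx => by simp [y, indicator_of_mem (show x ∈ Cᶜ from hx)]
    | some z, x, hx => by
      rw [← edist_eq_enorm_sub]
      exact le_add_right (Metric.mem_eball.1 hx).le
  obtain ⟨φ, hφ, hφU⟩ := exists_boundedContinuous_partition_subordinate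
    (Option.rec hC.isClosed.isOpen_compl fun _ => Metric.isOpen_eball) hU
  refine ⟨t, φ, y, hφ, fun x => ?_⟩
  calc ∑ i, φ i x * ‖x - y i‖ₑ
      ≤ ∑ i, φ i x * (ε + Cᶜ.indicator (fun x => ‖x‖ₑ) x) := Finset.sum_le_sum fun i _ => by
        rcases eq_or_ne (φ i x) 0 with h0 | h0
        · simp [h0]
        · gcongr
          exact hy i x (hφU i x h0)
    _ = ε + Cᶜ.indicator (fun x => ‖x‖ₑ) x := by
      rw [← Finset.sum_mul, ← ENNReal.ofNNReal_finsetSum, hφ, ENNReal.coe_one, one_mul]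

end Partition

section Quantization

variable {ι X : Type*} [Fintype ι] [TopologicalSpace X] [MeasurableSpace X]
  [OpensMeasurableSpace X]

/-- The discrete measure giving the node `y i` the mass `∫ φ i dμ`. For a continuous partition of
unity `φ` these masses depend continuously on `μ` for weak convergence. -/
noncomputable def quantize (φ : ι → X →ᵇ ℝ≥0) (y : ι → X) (μ : ProbabilityMeasure X) : Measure X :=
  ∑ i, μ.toFiniteMeasure.testAgainstNN (φ i) • Measure.dirac (y i)

theorem sum_testAgainstNN_eq_one {φ : ι → X →ᵇ ℝ≥0} (hφ : ∀ x, ∑ i, φ i x = 1)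
    (μ : ProbabilityMeasure X) : ∑ i, μ.toFiniteMeasure.testAgainstNN (φ i) = 1 := by
  have hadd := lintegral_finsetSum (μ := (μ : Measure X)) Finset.univ
    fun i _ => (φ i).continuous.measurable.coe_nnreal_ennreal
  simp_rw [← ENNReal.ofNNReal_finsetSum, hφ] at hadd
  rw [← ENNReal.coe_inj, ENNReal.ofNNReal_finsetSum]
  simpa [FiniteMeasure.testAgainstNN_coe_eq] using hadd.symm

theorem isProbabilityMeasure_quantize {φ : ι → X →ᵇ ℝ≥0} (hφ : ∀ x, ∑ i, φ i x = 1) (y : ι → X)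
    (μ : ProbabilityMeasure X) : IsProbabilityMeasure (quantize φ y μ) :=
  ⟨by simpa [quantize, Measure.finsetSum_apply, ENNReal.smul_def] using
    congrArg ENNReal.ofNNReal (sum_testAgainstNN_eq_one hφ μ)⟩

end Quantization

section QuantizationCost

variable {ι X : Type*} [Fintype ι] [NormedAddCommGroup X] [MeasurableSpace X] [BorelSpace X]
  [SecondCountableTopology X] {φ : ι → X →ᵇ ℝ≥0} (hφ : ∀ x, ∑ i, φ i x = 1) (y : ι → X)

include hφ

theorem transportCost_quantize_le (μ : ProbabilityMeasure X) :
    transportCost (μ : Measure X) (quantize φ y μ) ≤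
      ∫⁻ x, ∑ i, φ i x * ‖x - y i‖ₑ ∂(μ : Measure X) := by
  have hsum : ∑ i, (fun x => (φ i x : ℝ≥0∞)) = 1 := by
    ext x
    simp [← ENNReal.ofNNReal_finsetSum, hφ]
  convert transportCost_sum_lintegral_smul_dirac_le
    (fun i => (φ i).continuous.measurable.coe_nnreal_ennreal) hsum y (μ : Measure X) using 2
  simp_rw [quantize, ENNReal.smul_def, FiniteMeasure.testAgainstNN_coe_eq]
  rfl

theorem tendsto_transportCost_quantize {J : Type*} {L : Filter J} {μs : J → ProbabilityMeasure X}
    {μ : ProbabilityMeasure X} (hμ : Tendsto μs L (𝓝 μ)) :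
    Tendsto (fun j => transportCost (quantize φ y (μs j)) (quantize φ y μ)) L (𝓝 0) := by
  have hweight (i : ι) : Tendsto (fun j => edist ((μs j).toFiniteMeasure.testAgainstNN (φ i))
      (μ.toFiniteMeasure.testAgainstNN (φ i)) * ‖y i‖ₑ) L (𝓝 0) := by
    have h := ((ProbabilityMeasure.continuous_testAgainstNN_eval (φ i)).tendsto μ).comp hμ
    simpa using ENNReal.Tendsto.mul_const (tendsto_iff_edist_tendsto_0.1 h) (Or.inr enorm_ne_top)
  refine tendsto_of_tendsto_of_tendsto_of_le_of_le tendsto_const_nhds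
    (by simpa using tendsto_finsetSum Finset.univ fun i _ => hweight i) (fun _ => bot_le)
    fun j => ?_
  exact transportCost_sum_smul_dirac_le y
    ((sum_testAgainstNN_eq_one hφ (μs j)).trans (sum_testAgainstNN_eq_one hφ μ).symm)

end QuantizationCost

section MomentTight

variable {X : Type*} [NormedAddCommGroup X] [MeasurableSpace X]

/-- Tightness of a family of measures together with uniform integrability of the norm: both the
mass and the first moment are uniformly small off a compact set. -/
def IsMomentTight (S : Set (Measure X)) : Prop :=
  ∀ ε : ℝ≥0∞, 0 < ε → ∃ C, IsCompact C ∧ ∀ μ ∈ S, ∫⁻ x in Cᶜ, (1 + ‖x‖ₑ) ∂μ ≤ ε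

theorem IsMomentTight.isTightMeasureSet {S : Set (Measure X)} (hS : IsMomentTight S) :
    IsTightMeasureSet S := by
  refine isTightMeasureSet_iff_exists_isCompact_measure_compl_le.2 fun ε hε => ?_
  obtain ⟨C, hC, hCS⟩ := hS ε hε
  refine ⟨C, hC, fun μ hμ => ?_⟩
  calc μ Cᶜ = ∫⁻ _ in Cᶜ, 1 ∂μ := (setLIntegral_one _).symm
    _ ≤ ∫⁻ x in Cᶜ, (1 + ‖x‖ₑ) ∂μ := lintegral_mono fun _ => le_self_add
    _ ≤ ε := hCS μ hμ

/-- The underlying probability measure, used to speak of weak convergence in `PSpace p X`. -/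
def PSpace.toProbabilityMeasure {p : ℝ} (μ : PSpace p X) : ProbabilityMeasure X :=
  ⟨μ.meas, μ.isProb⟩

variable [BorelSpace X] [SecondCountableTopology X] [CompleteSpace X]

theorem IsMomentTight.tendsto_transportCost {S : Set (Measure X)} (hS : IsMomentTight S)
    {J : Type*} {L : Filter J} {μs : J → ProbabilityMeasure X} {μ : ProbabilityMeasure X}
    (hsS : ∀ᶠ j in L, (μs j : Measure X) ∈ S) (hμS : (μ : Measure X) ∈ S)
    (hμ : Tendsto μs L (𝓝 μ)) :
    Tendsto (fun j => transportCost (μs j : Measure X) μ) L (𝓝 0) := by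
  refine ENNReal.tendsto_nhds_zero.2 fun ε hε => ?_
  let η : ℝ≥0∞ := ε / 5
  have hη : 0 < η := ENNReal.div_pos hε.ne' (by simp)
  obtain ⟨C, hC, hCS⟩ := hS η hη
  obtain ⟨t, φ, y, hφ, hφC⟩ := exists_boundedContinuous_sum_mul_enorm_sub_le hC hη
  have := isProbabilityMeasure_quantize hφ y
  have hquant (ν : ProbabilityMeasure X) (hν : (ν : Measure X) ∈ S) :
      transportCost (ν : Measure X) (quantize φ y ν) ≤ η + η :=
    calc transportCost (ν : Measure X) (quantize φ y ν)
        ≤ ∫⁻ x, (η + Cᶜ.indicator (fun x => ‖x‖ₑ) x) ∂(ν : Measure X) :=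
          (transportCost_quantize_le hφ y ν).trans (lintegral_mono hφC)
      _ = η + ∫⁻ x in Cᶜ, ‖x‖ₑ ∂(ν : Measure X) := by
          rw [lintegral_add_left measurable_const, lintegral_indicator hC.measurableSet.compl]
          simp
      _ ≤ η + η := by
          gcongr
          exact (lintegral_mono fun _ => le_add_self).trans (hCS ν hν)
  filter_upwards [hsS, ENNReal.tendsto_nhds_zero.1 (tendsto_transportCost_quantize hφ y hμ) η hη]
    with j hj hnear
  calc transportCost (μs j : Measure X) μ
      ≤ transportCost (μs j : Measure X) (quantize φ y (μs j)) +
        (transportCost (quantize φ y (μs j)) (quantize φ y μ) +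
          transportCost (quantize φ y μ) (μ : Measure X)) :=
        (transportCost_triangle _ _ _).trans (by gcongr; exact transportCost_triangle _ _ _)
    _ ≤ (η + η) + (η + (η + η)) := by
        gcongr
        · exact hquant _ hj
        · exact (transportCost_comm_le _ _).trans (hquant _ hμS)
    _ = 5 * η := by ring
    _ = ε := ENNReal.mul_div_cancel (by simp) (by simp)

theorem isCompact_of_isMomentTight {S : Set (PSpace 1 X)} (hS : IsMomentTight (PSpace.meas '' S))
    (hclosed : IsClosed (PSpace.toProbabilityMeasure '' S)) : IsCompact S := by
  have hcompact : IsCompact (PSpace.toProbabilityMeasure '' S) := by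
    rw [← hclosed.closure_eq]
    refine isCompact_closure_of_isTightMeasureSet (hS.isTightMeasureSet.subset ?_)
    rintro _ ⟨_, ⟨μ, hμ, rfl⟩, rfl⟩
    exact mem_image_of_mem _ hμ
  refine isCompact_iff_ultrafilter_le_nhds.2 fun u hu => ?_
  have huS : ∀ᶠ ν in (u : Filter (PSpace 1 X)), ν ∈ S := le_principal_iff.1 hu
  obtain ⟨_, ⟨μ, hμ, rfl⟩, hlim⟩ :=
    isCompact_iff_ultrafilter_le_nhds.1 hcompact (u.map PSpace.toProbabilityMeasure)
      (tendsto_principal.2 <| huS.mono fun _ => mem_image_of_mem _)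
  have hlim : Tendsto PSpace.toProbabilityMeasure (u : Filter (PSpace 1 X))
    (𝓝 μ.toProbabilityMeasure) := hlim
  have hcost := hS.tendsto_transportCost (μ := μ.toProbabilityMeasure)
    (huS.mono fun _ => mem_image_of_mem _) (mem_image_of_mem _ hμ) hlim
  exact ⟨μ, hμ, tendsto_iff_dist_tendsto_zero.2 <|
    (ENNReal.tendsto_toReal ENNReal.zero_ne_top).comp hcost⟩

end MomentTight

section CompactEmbedding

variable {E F X : Type*} [NormedAddCommGroup E] [NormedAddCommGroup F] [NormedSpace ℝ F]
  [NormedAddCommGroup X] [NormedSpace ℝ X]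

theorem isCompactOperator_of_sq_norm_le [NormedSpace ℝ E] [CompleteSpace X] {S : E →L[ℝ] X}
    {T : E →L[ℝ] F} (hT : IsCompactOperator T) (hST : ∀ x, ‖S x‖ ^ 2 ≤ ‖T x‖ * ‖x‖) :
    IsCompactOperator S := by
  obtain ⟨K, hK, hTK⟩ :=
    IsCompactOperator.image_closedBall_subset_compact (f := (T : E →ₗ[ℝ] F)) hT 1
  refine (isCompactOperator_iff_isCompact_closure_image_closedBall (S : E →ₗ[ℝ] X) one_pos).2 ?_
  refine TotallyBounded.isCompact_of_isClosed (TotallyBounded.closure ?_) isClosed_closure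
  refine Metric.totallyBounded_iff.2 fun ε hε => ?_
  obtain ⟨t, htB, htf, ht⟩ := Metric.finite_approx_of_totallyBounded
    (hK.totallyBounded.subset hTK) (ε ^ 2 / 2) (by positivity)
  obtain ⟨s, hs, hsf, rfl⟩ := exists_subset_image_finite_and.1 ⟨t, htB, htf, rfl⟩
  refine ⟨S '' s, hsf.image _, ?_⟩
  rintro _ ⟨x, hx, rfl⟩
  obtain ⟨_, ⟨y, hy, rfl⟩, hxy⟩ := mem_iUnion₂.1 (ht (mem_image_of_mem _ hx))
  refine mem_iUnion₂.2 ⟨_, mem_image_of_mem _ hy, ?_⟩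
  have hxy2 : ‖x - y‖ ≤ 2 := by
    linarith [norm_sub_le x y, mem_closedBall_zero_iff.1 hx, mem_closedBall_zero_iff.1 (hs hy)]
  have hTxy : ‖T (x - y)‖ < ε ^ 2 / 2 := by simpa [dist_eq_norm] using hxy
  have hSxy : ‖S (x - y)‖ ^ 2 < ε ^ 2 := by nlinarith [hST (x - y), norm_nonneg (T (x - y))]
  simpa [dist_eq_norm] using lt_of_pow_lt_pow_left₀ 2 hε.le hSxy

variable [InnerProductSpace ℝ E] [CompleteSpace E]

-- Closed balls of `E` are weakly compact, hence so are their images, and weakly closed sets are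
-- closed. In place of a weak topology on `X`, `Z` pairs a point with the functionals on `E`
-- which represent it.
theorem isClosed_image_closedBall (ι : E →L[ℝ] X) (r : ℝ) :
    IsClosed (ι '' Metric.closedBall 0 r) := by
  let K : Set (WeakDual ℝ E) := WeakDual.toStrongDual ⁻¹' Metric.closedBall 0 r
  have hK : CompactSpace K := isCompact_iff_compactSpace.1 (WeakDual.isCompact_closedBall 0 r)
  let Z : Set (X × K) :=
    {p | ∀ ℓ : StrongDual ℝ X, ℓ p.1 = p.2.1 ((InnerProductSpace.toDual ℝ E).symm (ℓ.comp ι))}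
  have hZ : IsClosed Z := by
    simp only [Z, ofPred_forall]
    refine isClosed_iInter fun ℓ => isClosed_eq (by fun_prop) ?_
    exact (WeakDual.eval_continuous _).comp (continuous_subtype_val.comp continuous_snd)
  have heval (ℓ : StrongDual ℝ X) (x : E) :
      ℓ (ι x) = inner ℝ x ((InnerProductSpace.toDual ℝ E).symm (ℓ.comp ι)) := by
    rw [real_inner_comm, InnerProductSpace.toDual_symm_apply, ContinuousLinearMap.comp_apply]
  have himage : ι '' Metric.closedBall 0 r = Prod.fst '' Z := by
    ext y
    constructor
    · rintro ⟨x, hx, rfl⟩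
      refine ⟨(ι x, ⟨StrongDual.toWeakDual (InnerProductSpace.toDual ℝ E x), ?_⟩),
        fun ℓ => heval ℓ x, rfl⟩
      simpa [K] using hx
    · rintro ⟨⟨y, φ, hφ⟩, h, rfl⟩
      refine ⟨(InnerProductSpace.toDual ℝ E).symm (WeakDual.toStrongDual φ), ?_, ?_⟩
      · simpa [K] using hφ
      · refine (SeparatingDual.eq_iff_forall_dual_eq (R := ℝ)).2 fun ℓ => ?_
        rw [heval, InnerProductSpace.toDual_symm_apply]
        exact (h ℓ).symm
  exact himage ▸ isClosedMap_fst_of_compactSpace _ hZ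

theorem isCompact_image_closedBall {ι : E →L[ℝ] X} (hι : IsCompactOperator ι) (r : ℝ) :
    IsCompact (ι '' Metric.closedBall 0 r) := by
  obtain ⟨K, hK, hιK⟩ :=
    IsCompactOperator.image_closedBall_subset_compact (f := (ι : E →ₗ[ℝ] X)) hι r
  exact hK.of_isClosed_subset (isClosed_image_closedBall ι r) hιK

end CompactEmbedding

section Map

variable {E X : Type*} [NormedAddCommGroup E] [NormedSpace ℝ E] [MeasurableSpace E] [BorelSpace E]
  [NormedAddCommGroup X] [NormedSpace ℝ X] [MeasurableSpace X] [BorelSpace X]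

/-- Push-forward by a bounded operator, `𝒫_1(E) → 𝒫_1(X)`. -/
noncomputable def PSpace.map (ι : E →L[ℝ] X) (μ : PSpace 1 E) : PSpace 1 X where
  meas := μ.meas.map ι
  isProb := Measure.isProbabilityMeasure_map ι.continuous.measurable.aemeasurable
  moment := by
    rw [lintegral_map (by fun_prop) ι.continuous.measurable]
    calc ∫⁻ x, ‖ι x‖ₑ ^ (1 : ℝ) ∂μ.meas
        ≤ ∫⁻ x, ‖ι‖ₑ * ‖x‖ₑ ^ (1 : ℝ) ∂μ.meas := lintegral_mono fun x => by
          simpa only [ENNReal.rpow_one] using ι.le_opENorm x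
      _ = ‖ι‖ₑ * ∫⁻ x, ‖x‖ₑ ^ (1 : ℝ) ∂μ.meas := lintegral_const_mul _ (by fun_prop)
      _ < ∞ := ENNReal.mul_lt_top enorm_lt_top μ.moment

theorem natCast_mul_setLIntegral_compl_closedBall_le (ι : E →L[ℝ] X) (μ : Measure E) {n : ℕ}
    (hn : 1 ≤ n) : n * ∫⁻ x in (Metric.closedBall 0 n)ᶜ, (1 + ‖ι x‖ₑ) ∂μ ≤
      (1 + ‖ι‖ₑ) * ∫⁻ x, ‖x‖ₑ ^ 2 ∂μ := by
  have hle : ∀ x ∈ (Metric.closedBall (0 : E) n)ᶜ,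
      n * (1 + ‖ι x‖ₑ) ≤ (1 + ‖ι‖ₑ) * ‖x‖ₑ ^ 2 := by
    intro x hx
    have hnx : (n : ℝ≥0∞) ≤ ‖x‖ₑ := by
      rw [mem_compl_iff, mem_closedBall_zero_iff, not_le] at hx
      rw [enorm_eq_nnnorm]
      exact_mod_cast hx.le
    have hx1 : 1 ≤ ‖x‖ₑ := le_trans (by exact_mod_cast hn) hnx
    calc n * (1 + ‖ι x‖ₑ) ≤ ‖x‖ₑ * (‖x‖ₑ + ‖ι‖ₑ * ‖x‖ₑ) := by
          gcongr
          exact ι.le_opENorm x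
      _ = (1 + ‖ι‖ₑ) * ‖x‖ₑ ^ 2 := by ring
  calc n * ∫⁻ x in (Metric.closedBall 0 n)ᶜ, (1 + ‖ι x‖ₑ) ∂μ
      = ∫⁻ x in (Metric.closedBall 0 n)ᶜ, n * (1 + ‖ι x‖ₑ) ∂μ :=
        (lintegral_const_mul _ (by fun_prop)).symm
    _ ≤ ∫⁻ x in (Metric.closedBall 0 n)ᶜ, (1 + ‖ι‖ₑ) * ‖x‖ₑ ^ 2 ∂μ :=
        setLIntegral_mono' Metric.isClosed_closedBall.measurableSet.compl hle
    _ ≤ ∫⁻ x, (1 + ‖ι‖ₑ) * ‖x‖ₑ ^ 2 ∂μ := setLIntegral_le_lintegral _ _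
    _ = (1 + ‖ι‖ₑ) * ∫⁻ x, ‖x‖ₑ ^ 2 ∂μ := lintegral_const_mul _ (by fun_prop)

theorem isMomentTight_image_map_momentBall {ι : E →L[ℝ] X}
    (hι : ∀ r, IsCompact (ι '' Metric.closedBall 0 r)) (c : ℝ≥0) :
    IsMomentTight (PSpace.meas '' (PSpace.map ι '' momentBall E c)) := by
  intro ε hε
  obtain ⟨n, hn⟩ := ENNReal.exists_nat_mul_gt hε.ne'
    (ENNReal.mul_ne_top (ENNReal.add_ne_top.2 ⟨ENNReal.one_ne_top, enorm_ne_top⟩)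
      ENNReal.coe_ne_top : (1 + ‖ι‖ₑ) * c ≠ ∞)
  refine ⟨ι '' Metric.closedBall 0 ((n + 1 : ℕ) : ℝ), hι _, ?_⟩
  rintro _ ⟨_, ⟨μ, hμ, rfl⟩, rfl⟩
  have htail : ((n + 1 : ℕ) : ℝ≥0∞) *
      ∫⁻ x in (Metric.closedBall 0 ((n + 1 : ℕ) : ℝ))ᶜ, (1 + ‖ι x‖ₑ) ∂μ.meas ≤
        (n + 1 : ℕ) * ε :=
    calc _ ≤ (1 + ‖ι‖ₑ) * ∫⁻ x, ‖x‖ₑ ^ 2 ∂μ.meas :=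
          natCast_mul_setLIntegral_compl_closedBall_le ι μ.meas (Nat.le_add_left 1 n)
      _ ≤ (1 + ‖ι‖ₑ) * c := by
          gcongr
          exact hμ
      _ ≤ n * ε := hn.le
      _ ≤ (n + 1 : ℕ) * ε := by gcongr; simp
  calc ∫⁻ x in (ι '' Metric.closedBall 0 ((n + 1 : ℕ) : ℝ))ᶜ, (1 + ‖x‖ₑ) ∂(μ.map ι).meas
      = ∫⁻ x in ι ⁻¹' (ι '' Metric.closedBall 0 ((n + 1 : ℕ) : ℝ))ᶜ, (1 + ‖ι x‖ₑ) ∂μ.meas :=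
        setLIntegral_map (hι _).measurableSet.compl (by fun_prop) ι.continuous.measurable
    _ ≤ ∫⁻ x in (Metric.closedBall 0 ((n + 1 : ℕ) : ℝ))ᶜ, (1 + ‖ι x‖ₑ) ∂μ.meas :=
        lintegral_mono_set (compl_subset_compl.2 (subset_preimage_image ι _))
    _ ≤ ε := (ENNReal.mul_le_mul_iff_right (by simp) (ENNReal.natCast_ne_top _)).1 htail

end Map

section LayerCake

theorem isClosed_setOf_lintegral_measure_compl_le {X : Type*} [PseudoMetricSpace X]
    [SecondCountableTopology X] [MeasurableSpace X] [BorelSpace X] {F : ℝ → Set X}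
    (hF : Monotone F) (hclosed : ∀ t, IsClosed (F t)) (s : Set ℝ) (c : ℝ≥0∞) :
    IsClosed {ν : ProbabilityMeasure X | ∫⁻ t in s, (ν : Measure X) (F t)ᶜ ≤ c} := by
  refine IsSeqClosed.isClosed fun νs ν hνs hν => ?_
  calc ∫⁻ t in s, (ν : Measure X) (F t)ᶜ
      ≤ ∫⁻ t in s, liminf (fun n => (νs n : Measure X) (F t)ᶜ) atTop :=
        lintegral_mono fun t =>
          ProbabilityMeasure.le_liminf_measure_open_of_tendsto hν (hclosed t).isOpen_compl
    _ ≤ liminf (fun n => ∫⁻ t in s, (νs n : Measure X) (F t)ᶜ) atTop :=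
        lintegral_liminf_le fun n => Antitone.measurable fun t t' htt' =>
          measure_mono (compl_subset_compl.2 (hF htt'))
    _ ≤ c := liminf_le_of_le (by isBoundedDefault) fun b hb =>
        let ⟨n, hn⟩ := hb.exists
        hn.trans (hνs n)

theorem lintegral_measure_compl_closedBall_sqrt {E : Type*} [NormedAddCommGroup E]
    [MeasurableSpace E] [OpensMeasurableSpace E] (μ : Measure E) :
    ∫⁻ t in Ioi (0 : ℝ), μ (Metric.closedBall 0 √t)ᶜ = ∫⁻ x, ‖x‖ₑ ^ 2 ∂μ := by
  simp_rw [← ofReal_norm, ← ENNReal.ofReal_pow (norm_nonneg _)]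
  rw [lintegral_eq_lintegral_meas_lt μ (Eventually.of_forall fun x => sq_nonneg _)
    (by fun_prop)]
  refine setLIntegral_congr_fun measurableSet_Ioi fun t ht => congrArg μ ?_
  ext x
  rw [mem_compl_iff, mem_closedBall_zero_iff, not_le, mem_ofPred_eq,
    Real.sqrt_lt (mem_Ioi.1 ht).le (norm_nonneg x)]

theorem measure_compl_range_eq_zero_of_lintegral {α X : Type*} [MeasurableSpace X] {ν : Measure X}
    {f : α → X} {A : ℝ → Set α} (h : ∫⁻ t in Ioi (0 : ℝ), ν (f '' A t)ᶜ ≠ ∞) :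
    ν (range f)ᶜ = 0 := by
  by_contra h0
  refine h (eq_top_mono (lintegral_mono fun t => measure_mono <|
    compl_subset_compl.2 (image_subset_range f (A t))) ?_)
  rw [setLIntegral_const, Real.volume_Ioi, ENNReal.mul_top h0]

theorem lintegral_enorm_rpow_one_lt_top_of_sq {E : Type*} [NormedAddCommGroup E]
    [MeasurableSpace E] {μ : Measure E} [IsFiniteMeasure μ] (h : ∫⁻ x, ‖x‖ₑ ^ 2 ∂μ < ∞) :
    ∫⁻ x, ‖x‖ₑ ^ (1 : ℝ) ∂μ < ∞ := by
  have hle (x : E) : ‖x‖ₑ ^ (1 : ℝ) ≤ 1 + ‖x‖ₑ ^ 2 := by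
    rw [ENNReal.rpow_one]
    rcases le_total ‖x‖ₑ 1 with hx | hx
    · exact hx.trans le_self_add
    · exact (le_self_pow₀ hx two_ne_zero).trans le_add_self
  calc ∫⁻ x, ‖x‖ₑ ^ (1 : ℝ) ∂μ ≤ ∫⁻ x, (1 + ‖x‖ₑ ^ 2) ∂μ := lintegral_mono hle
    _ = μ univ + ∫⁻ x, ‖x‖ₑ ^ 2 ∂μ := by rw [lintegral_add_left measurable_const, lintegral_one]
    _ < ∞ := ENNReal.add_lt_top.2 ⟨measure_lt_top μ univ, h⟩

end LayerCake

section Compactness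

variable {E X : Type*} [NormedAddCommGroup E] [InnerProductSpace ℝ E] [CompleteSpace E]
  [MeasurableSpace E] [BorelSpace E] [NormedAddCommGroup X] [NormedSpace ℝ X] [MeasurableSpace X]
  [BorelSpace X] {ι : E →L[ℝ] X}

theorem lintegral_measure_map_compl_image_closedBall (hι : Function.Injective ι) (μ : Measure E) :
    ∫⁻ t in Ioi (0 : ℝ), μ.map ι (ι '' Metric.closedBall 0 √t)ᶜ = ∫⁻ x, ‖x‖ₑ ^ 2 ∂μ := by
  rw [← lintegral_measure_compl_closedBall_sqrt]
  refine lintegral_congr fun t => ?_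
  rw [Measure.map_apply ι.continuous.measurable
    (isClosed_image_closedBall ι _).measurableSet.compl, preimage_compl, hι.preimage_image]

variable [SecondCountableTopology E]

theorem mem_image_map_momentBall_iff (hι : Function.Injective ι) (c : ℝ≥0)
    (ν : ProbabilityMeasure X) :
    ν ∈ PSpace.toProbabilityMeasure '' (PSpace.map ι '' momentBall E c) ↔
      ∫⁻ t in Ioi (0 : ℝ), (ν : Measure X) (ι '' Metric.closedBall 0 √t)ᶜ ≤ c := by
  constructor
  · rintro ⟨_, ⟨μ, hμ, rfl⟩, rfl⟩
    exact (lintegral_measure_map_compl_image_closedBall hι μ.meas).trans_le hμ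
  · intro h
    let μ := (ν : Measure X).comap ι
    have hrange := measure_compl_range_eq_zero_of_lintegral (h.trans_lt ENNReal.coe_lt_top).ne
    have hmap : μ.map ι = ν := by
      rw [(ι.continuous.measurableEmbedding hι).map_comap]
      exact Measure.restrict_eq_self_of_ae_mem (mem_ae_iff.2 hrange)
    have hprob : IsProbabilityMeasure (μ.map ι) := hmap ▸ inferInstance
    have hμ : IsProbabilityMeasure μ := Measure.isProbabilityMeasure_of_map ι
    have hmom : ∫⁻ x, ‖x‖ₑ ^ 2 ∂μ ≤ c := by
      rwa [← lintegral_measure_map_compl_image_closedBall hι, hmap]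
    exact ⟨_, ⟨⟨μ, hμ, lintegral_enorm_rpow_one_lt_top_of_sq (hmom.trans_lt ENNReal.coe_lt_top)⟩,
      hmom, rfl⟩, Subtype.ext hmap⟩

variable [CompleteSpace X] [SecondCountableTopology X]

theorem isCompact_image_map_momentBall (hι : Function.Injective ι) (hcomp : IsCompactOperator ι)
    (c : ℝ≥0) : IsCompact (PSpace.map ι '' momentBall E c) := by
  refine isCompact_of_isMomentTight
    (isMomentTight_image_map_momentBall (isCompact_image_closedBall hcomp) c) ?_
  have hclosed := isClosed_setOf_lintegral_measure_compl_le
    (F := fun t => ι '' Metric.closedBall 0 √t)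
    (fun t t' htt' => image_mono (Metric.closedBall_subset_closedBall (Real.sqrt_le_sqrt htt')))
    (fun t => isClosed_image_closedBall ι √t) (Ioi 0) c
  exact (ext (mem_image_map_momentBall_iff hι c) :) ▸ hclosed

end Compactness

section Convexity

variable {E X : Type*} [NormedAddCommGroup E] [MeasurableSpace E] [NormedAddCommGroup X]
  [MeasurableSpace X] {a b : ℝ≥0}

/-- The convex combination `a μ + b ν` in `𝒫_p(X)`. -/
noncomputable def PSpace.combo {p : ℝ} (hab : a + b = 1) (μ ν : PSpace p X) : PSpace p X where
  meas := a • μ.meas + b • ν.meas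
  isProb := ⟨by simpa using by exact_mod_cast hab⟩
  moment := by
    rw [lintegral_add_measure, lintegral_smul_measure, lintegral_smul_measure]
    exact ENNReal.add_lt_top.2 ⟨ENNReal.mul_lt_top ENNReal.coe_lt_top μ.moment,
      ENNReal.mul_lt_top ENNReal.coe_lt_top ν.moment⟩

theorem combo_mem_momentBall (hab : a + b = 1) {c : ℝ≥0} {μ ν : PSpace 1 E}
    (hμ : μ ∈ momentBall E c) (hν : ν ∈ momentBall E c) : μ.combo hab ν ∈ momentBall E c :=
  calc ∫⁻ x, ‖x‖ₑ ^ 2 ∂(a • μ.meas + b • ν.meas)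
      = a * ∫⁻ x, ‖x‖ₑ ^ 2 ∂μ.meas + b * ∫⁻ x, ‖x‖ₑ ^ 2 ∂ν.meas := by
        rw [lintegral_add_measure, lintegral_smul_measure, lintegral_smul_measure]
        rfl
    _ ≤ a * c + b * c := by
        gcongr
        · exact hμ
        · exact hν
    _ = c := by rw [← add_mul, ← ENNReal.coe_add, hab, ENNReal.coe_one, one_mul]

variable [BorelSpace X]

theorem PSpace.map_combo [NormedSpace ℝ E] [BorelSpace E] [NormedSpace ℝ X] (ι : E →L[ℝ] X)
    (hab : a + b = 1) (μ ν : PSpace 1 E) :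
    (μ.combo hab ν).map ι = (μ.map ι).combo hab (ν.map ι) := by
  refine PSpace.ext ?_
  simp only [map, combo, Measure.map_add _ _ ι.continuous.measurable, Measure.map_smul]

variable [SecondCountableTopology X] [CompleteSpace X]

theorem PSpace.dist_combo_le (hab : a + b = 1) (μ μ' ν ν' : PSpace 1 X) :
    dist (μ.combo hab μ') (ν.combo hab ν') ≤ a * dist μ ν + b * dist μ' ν' := by
  have hcost : transportCost (μ.combo hab μ').meas (ν.combo hab ν').meas ≤
      a * transportCost μ.meas ν.meas + b * transportCost μ'.meas ν'.meas :=
    (transportCost_add_le _ _ _ _).trans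
      (add_le_add (transportCost_smul_le a _ _) (transportCost_smul_le b _ _))
  have hμν : a * transportCost μ.meas ν.meas ≠ ∞ :=
    ENNReal.mul_ne_top ENNReal.coe_ne_top (transportCost_ne_top μ ν)
  have hμν' : b * transportCost μ'.meas ν'.meas ≠ ∞ :=
    ENNReal.mul_ne_top ENNReal.coe_ne_top (transportCost_ne_top μ' ν')
  calc dist (μ.combo hab μ') (ν.combo hab ν')
      ≤ (a * transportCost μ.meas ν.meas + b * transportCost μ'.meas ν'.meas).toReal :=
        ENNReal.toReal_mono (ENNReal.add_ne_top.2 ⟨hμν, hμν'⟩) hcost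
    _ = a * dist μ ν + b * dist μ' ν' := by
        rw [ENNReal.toReal_add hμν hμν', ENNReal.toReal_mul, ENNReal.toReal_mul]
        rfl

end Convexity

section ArzelaAscoli

variable {I Y : Type*} [PseudoMetricSpace I] [PseudoMetricSpace Y] {b : ℝ → ℝ}

theorem continuous_of_dist_le_modulus (hb : Tendsto b (𝓝 0) (𝓝 0)) {f : I → Y}
    (hf : ∀ s t, dist (f s) (f t) ≤ b (dist s t)) : Continuous f :=
  (Metric.equicontinuous_of_continuity_modulus b hb (fun _ : Unit => f)
    fun s t _ => hf s t).continuous ()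

theorem isCompact_setOf_dist_le_modulus (hb : Tendsto b (𝓝 0) (𝓝 0)) {K : Set Y}
    (hK : IsCompact K) :
    IsCompact {f : C(I, Y) | (∀ t, f t ∈ K) ∧ ∀ s t, dist (f s) (f t) ≤ b (dist s t)} := by
  refine ArzelaAscoli.isCompact_of_equicontinuous _ ?_
    (Metric.equicontinuous_of_continuity_modulus b hb _ fun s t f => f.2.2 s t)
  have hclosed : IsClosed {f : I → Y | ∀ s t, dist (f s) (f t) ≤ b (dist s t)} := by
    simp only [ofPred_forall]
    exact isClosed_iInter fun s => isClosed_iInter fun t =>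
      isClosed_le ((continuous_apply s).dist (continuous_apply t)) continuous_const
  convert (isCompact_univ_pi fun _ : I => hK).inter_right hclosed using 1
  ext f
  constructor
  · rintro ⟨f, ⟨hfK, hf⟩, rfl⟩
    exact ⟨fun t _ => hfK t, hf⟩
  · rintro ⟨hfK, hf⟩
    exact ⟨⟨f, continuous_of_dist_le_modulus hb hf⟩, ⟨fun t => hfK t (mem_univ t), hf⟩, rfl⟩

theorem tendsto_const_mul_sqrt_nhds_zero (M : ℝ) : Tendsto (fun r => M * √r) (𝓝 0) (𝓝 0) := by
  simpa using (Real.continuous_sqrt.const_mul M).tendsto 0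

end ArzelaAscoli

section WeakSpace

variable {H : Type*} [NormedAddCommGroup H] [InnerProductSpace ℝ H] [CompleteSpace H]
  (B : StrictlyPositiveOperator H)

/-- The embedding `toWeak B` of `H` into `H₋₁` as a bounded operator. -/
noncomputable def toWeakL : H →L[ℝ] WeakSpace B :=
  LinearMap.mkContinuous
    { toFun := toWeak B
      map_add' := fun x y => UniformSpace.Completion.coe_add (toPreWeak B x) (toPreWeak B y)
      map_smul' := fun r x => UniformSpace.Completion.coe_smul r (toPreWeak B x) }
    (√‖B.op‖) (norm_toWeak_le B)

theorem toWeakL_injective : Function.Injective (toWeakL B) :=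
  fun _ _ h => UniformSpace.Completion.coe_injective (PreWeak B) h

theorem sq_norm_toWeakL_le (x : H) : ‖toWeakL B x‖ ^ 2 ≤ ‖B.op x‖ * ‖x‖ := by
  have hnorm : ‖toWeakL B x‖ = √(inner ℝ (B.op x) x) :=
    UniformSpace.Completion.norm_coe (toPreWeak B x)
  have hnonneg : 0 ≤ inner ℝ (B.op x) x := (weakCore B).re_inner_nonneg x
  rw [hnorm, Real.sq_sqrt hnonneg]
  exact real_inner_le_norm _ _

theorem isCompactOperator_toWeakL (hB : IsCompactOperator B.op) : IsCompactOperator (toWeakL B) :=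
  isCompactOperator_of_sq_norm_le hB (sq_norm_toWeakL_le B)

variable [MeasurableSpace H] [BorelSpace H] [TopologicalSpace.SeparableSpace H]

theorem isCompact_toWeak_image_momentBall (hB : IsCompactOperator B.op) (c : ℝ≥0) :
    IsCompact (PSpace.toWeak B '' momentBall H c) := by
  have := UniformSpace.secondCountable_of_separable H
  exact isCompact_image_map_momentBall (toWeakL_injective B) (isCompactOperator_toWeakL B hB) c

theorem map_toWeak_injective :
    Function.Injective (fun μ : Measure H => μ.map (toWeak B)) := by
  have := UniformSpace.secondCountable_of_separable H
  exact ((toWeakL B).continuous.measurableEmbedding (toWeakL_injective B)).map_injective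

end WeakSpace

section Flows

variable {H : Type*} [NormedAddCommGroup H] [InnerProductSpace ℝ H] [CompleteSpace H]
  [MeasurableSpace H] [BorelSpace H] [TopologicalSpace.SeparableSpace H]
  (B : StrictlyPositiveOperator H) {T : ℝ} (hT : 0 < T)

theorem continuous_of_mem_holderFlows {m₀ : PSpace 2 H} {c M : ℝ≥0} {m : Icc 0 T → PSpace 1 H}
    (hm : m ∈ holderFlows B hT m₀ c M) : Continuous fun t => (m t).toWeak B :=
  continuous_of_dist_le_modulus (tendsto_const_mul_sqrt_nhds_zero M) fun s t => hm.2.2 t s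

theorem holderFlowsInC_eq (m₀ : PSpace 2 H) (c M : ℝ≥0) :
    holderFlowsInC B hT m₀ c M =
      {f | (∀ t, f t ∈ PSpace.toWeak B '' momentBall H c) ∧
        ∀ s t, dist (f s) (f t) ≤ M * √(dist s t)} ∩
      {f | (f ⟨0, left_mem_Icc.2 hT.le⟩).meas = m₀.meas.map (toWeak B)} := by
  ext f
  constructor
  · rintro ⟨m, ⟨hmQ, hm₀, hmM⟩, hf⟩
    refine ⟨⟨fun t => ⟨m t, hmQ t, (hf t).symm⟩, fun s t => ?_⟩, ?_⟩
    · rw [hf, hf]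
      exact hmM t s
    · exact (congrArg PSpace.meas (hf _)).trans (congrArg (Measure.map (toWeak B)) hm₀)
  · rintro ⟨⟨hfQ, hfM⟩, hf₀⟩
    choose m hmQ hm using hfQ
    refine ⟨m, ⟨hmQ, map_toWeak_injective B ?_, fun s t => ?_⟩, fun t => (hm t).symm⟩
    · exact (congrArg PSpace.meas (hm _)).trans hf₀
    · rw [hm, hm]
      exact hfM t s

theorem isCompact_holderFlowsInC (hB : IsCompactOperator B.op) (m₀ : PSpace 2 H) (c M : ℝ≥0) :
    IsCompact (holderFlowsInC B hT m₀ c M) := by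
  have hinitial : {ν : PSpace 1 (WeakSpace B) | ν.meas = m₀.meas.map (toWeak B)}.Subsingleton :=
    fun _ hμ _ hν => PSpace.ext (hμ.trans hν.symm)
  rw [holderFlowsInC_eq]
  exact (isCompact_setOf_dist_le_modulus (tendsto_const_mul_sqrt_nhds_zero M)
    (isCompact_toWeak_image_momentBall B hB c)).inter_right
      (hinitial.isClosed.preimage (continuous_eval_const _))

theorem combo_mem_holderFlows {m₀ : PSpace 2 H} {c M a b : ℝ≥0} (hab : a + b = 1)
    {m m' : Icc 0 T → PSpace 1 H} (hm : m ∈ holderFlows B hT m₀ c M)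
    (hm' : m' ∈ holderFlows B hT m₀ c M) :
    (fun t => (m t).combo hab (m' t)) ∈ holderFlows B hT m₀ c M := by
  obtain ⟨hmQ, hm₀, hmM⟩ := hm
  obtain ⟨hmQ', hm₀', hmM'⟩ := hm'
  refine ⟨fun t => combo_mem_momentBall hab (hmQ t) (hmQ' t), ?_, fun s t => ?_⟩
  · simp only [PSpace.combo, hm₀, hm₀', ← add_smul, hab, one_smul]
  · calc dist (((m t).combo hab (m' t)).toWeak B) (((m s).combo hab (m' s)).toWeak B)
        = dist (((m t).toWeak B).combo hab ((m' t).toWeak B))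
            (((m s).toWeak B).combo hab ((m' s).toWeak B)) :=
          congrArg₂ dist (PSpace.map_combo (toWeakL B) hab _ _)
            (PSpace.map_combo (toWeakL B) hab _ _)
      _ ≤ a * dist ((m t).toWeak B) ((m s).toWeak B) +
            b * dist ((m' t).toWeak B) ((m' s).toWeak B) := PSpace.dist_combo_le hab _ _ _ _
      _ ≤ a * (M * √|(t : ℝ) - s|) + b * (M * √|(t : ℝ) - s|) := by
          gcongr
          · exact hmM s t
          · exact hmM' s t
      _ = M * √|(t : ℝ) - s| := by rw [← add_mul, ← NNReal.coe_add, hab, NNReal.coe_one, one_mul]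

theorem convex_toSignedFlow_image_holderFlowsInC (m₀ : PSpace 2 H) (c M : ℝ≥0) :
    Convex ℝ (toSignedFlow '' holderFlowsInC B hT m₀ c M) := by
  rintro _ ⟨f, ⟨m, hm, hf⟩, rfl⟩ _ ⟨g, ⟨m', hm', hg⟩, rfl⟩ a b ha hb hab
  lift a to ℝ≥0 using ha
  lift b to ℝ≥0 using hb
  have hab : a + b = 1 := by exact_mod_cast hab
  have hmem := combo_mem_holderFlows B hT hab hm hm'
  refine ⟨⟨_, continuous_of_mem_holderFlows B hT hmem⟩, ⟨_, hmem, fun _ => rfl⟩, funext fun t => ?_⟩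
  calc (((m t).combo hab (m' t)).toWeak B).meas.toSignedMeasure
      = (((m t).toWeak B).combo hab ((m' t).toWeak B)).meas.toSignedMeasure := by
        congr 2
        exact PSpace.map_combo (toWeakL B) hab _ _
    _ = ((f t).combo hab (g t)).meas.toSignedMeasure := by simp only [hf, hg]
    _ = a • (f t).meas.toSignedMeasure + b • (g t).meas.toSignedMeasure :=
        (Measure.toSignedMeasure_add _ _).trans
          (congrArg₂ _ (Measure.toSignedMeasure_smul _ _) (Measure.toSignedMeasure_smul _ _))

end Flows

end HilbertFlow

theorem mainTheorem8 {H : Type*} [NormedAddCommGroup H] [InnerProductSpace ℝ H] [CompleteSpace H]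
    [TopologicalSpace.SeparableSpace H] [MeasurableSpace H] [BorelSpace H]
    (B : StrictlyPositiveOperator H) (hB : IsCompactOperator B.op)
    {T : ℝ} (hT : 0 < T) (m₀ : PSpace 2 H) (c M : ℝ≥0) :
    (∀ m ∈ holderFlows B hT m₀ c M, Continuous fun t => (m t).toWeak B) ∧
      Convex ℝ (toSignedFlow '' holderFlowsInC B hT m₀ c M) ∧
      IsCompact (holderFlowsInC B hT m₀ c M) :=
  ⟨fun _ hm => continuous_of_mem_holderFlows B hT hm,
    convex_toSignedFlow_image_holderFlowsInC B hT m₀ c M,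
    isCompact_holderFlowsInC B hT hB m₀ c M⟩
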